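/- Let $(q_k)_{k\ge 1}$ be a sequence of positive integers with $q_{k+1}\ge q_k(q_k+1)$ for all $k$, and for each $k$ let $p_{0k},p_{1k}\in[0,1]$ with $p_{0k}+p_{1k}=1$. Let $\xi_1,\xi_2,\dots$ be independent random variables with $P(\xi_k=i)=p_{ik}$ for $i\in\{0,1\}$, and let $\mu$ be the distribution of $\xi=\sum_{k\ge1}(-1)^{k+1}\xi_k/q_k$, $F_\xi$ its distribution function, and $S_\mu$ its topological support. Let $\nu^*$ be the distribution of $\xi^*=\sum_{k\ge1}(-1)^{k+1}\xi^*_k/q_k$, where the $\xi_k^*$ are independent, take the values $i\in\{0,1\}$ with probabilities $p^*_{ik}$, and $p^*_{ik}=0,\,1,\,\tfrac12$ according as $p_{ik}=0$, $p_{ik}=1$, $p_{ik}\in(0,1)$. For a continuous (that is, non-atomic) probability measure $\nu$ on $\mathbb R$, a set $E\subseteq\mathbb R$ and $\alpha>0$ put $$H^\alpha(E,\nu)=\lim_{\varepsilon\to0}\ \inf\Big\{\sum_j \nu(E_j)^\alpha\Big\},$$ where the infimum is over the at most countable coverings $\{E_j\}$ of $E$ by closed intervals with $\nu(E_j)\le\varepsilon$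 for all $j$. The Hausdorff–Billingsley dimension of $E$ with respect to $\nu$ is $\dim_H(E,\nu)=\inf\{\alpha>0: H^\alpha(E,\nu)=0\}$, and that of a probability measure $\mu$ with respect to $\nu$ is $\dim_H(\mu,\nu)=\inf\{\dim_H(E,\nu): E \text{ Borel},\ \mu(E)=1\}$. The distribution function $F_\xi$ is said to preserve the Hausdorff–Billingsley dimension on $S_\mu$ if $\dim_H(E,\mu)=\dim_H(E,\nu^*)$ for every $E\subseteq S_\mu$. Let $h_k=-(p_{0k}\ln p_{0k}+p_{1k}\ln p_{1k})$ (with $0\ln 0=0$), $H_n=h_1+\dots+h_n$, and let $g_n$ be the number of positive elements among $h_1,\dots,h_n$. **Theorem.** Suppose that there is a constant $p_0>0$ with $p_{ik}>p_0$ for all $i\in\{0,1\}$ and all $k\ge1$ (so that $\mu$ and $\nu^*$ are continuous). Then $F_\xi$ preserves the Hausdorff–Billingsley dimension on $S_\mu$ if and only if $\dim_H(\mu,\nu^*)=1$. Moreover, $\dim_H(\mu,\nu^*)=1$ if and only if $$\liminf_{n\to\infty}\frac{H_n}{g_n\ln2}=1 .$$ -/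

import Mathlib

open MeasureTheory ProbabilityTheory Filter
open scoped ENNReal NNReal

noncomputable section

/-- Denominators of a second Ostrogradsky series, indexed from `0`: `q k` is the `(k+1)`-st
denominator. -/
def IsSecondOstrogradsky (q : ℕ → ℕ) : Prop :=
  (∀ k, 0 < q k) ∧ ∀ k, q k * (q k + 1) ≤ q (k + 1)

/-- The random incomplete sum `∑ (-1)^(k+1) ξ_k / q_k`, `k = 1, 2, …`, written with indices
from `0`. -/
def ostrogradskySum {Ω : Type*} (q : ℕ → ℕ) (ξ : ℕ → Ω → Fin 2) (ω : Ω) : ℝ :=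
  ∑' k : ℕ, (-1 : ℝ) ^ k * ((ξ k ω : ℕ) : ℝ) / (q k : ℝ)

/-- `ξ` is a sequence of independent random variables, `ξ k` taking the values `0` and `1` with
the probabilities `p 0 k` and `p 1 k`. -/
structure IsBernoulliSeq {Ω : Type*} [MeasurableSpace Ω] (P : Measure Ω)
    (p : Fin 2 → ℕ → ℝ) (ξ : ℕ → Ω → Fin 2) : Prop where
  measurable : ∀ k, Measurable (ξ k)
  indep : iIndepFun ξ P
  prob : ∀ i k, P {ω | ξ k ω = i} = ENNReal.ofReal (p i k)

/-- The probabilities of the uniform distribution on the spectrum: the values `0` and `1` are kept,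
and every probability strictly between them is replaced by `1 / 2`. -/
def uniformProb (p : Fin 2 → ℕ → ℝ) (i : Fin 2) (k : ℕ) : ℝ :=
  if p i k = 0 then 0 else if p i k = 1 then 1 else 1 / 2

/-- The infimum of `∑ ν(E_j)^α` over the countable coverings of `E` by closed intervals
`E_j = [c_j, d_j]` with `ν(E_j) ≤ ε`. (An interval with `d_j < c_j` is empty and contributes `0`,
so finite coverings are included.) -/
def hbPremeasure (ν : Measure ℝ) (α : ℝ≥0) (ε : ℝ≥0∞) (E : Set ℝ) : ℝ≥0∞ :=
  ⨅ (c : ℕ → ℝ) (d : ℕ → ℝ) (_ : E ⊆ ⋃ j, Set.Icc (c j) (d j))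
    (_ : ∀ j, ν (Set.Icc (c j) (d j)) ≤ ε), ∑' j, ν (Set.Icc (c j) (d j)) ^ (α : ℝ)

/-- The `ν`-`α`-Hausdorff–Billingsley measure of `E`: the limit, which is the supremum, of the
premeasures as `ε → 0`. -/
def hbMeasure (ν : Measure ℝ) (α : ℝ≥0) (E : Set ℝ) : ℝ≥0∞ :=
  ⨆ (ε : ℝ≥0∞) (_ : 0 < ε), hbPremeasure ν α ε E

/-- The Hausdorff–Billingsley dimension of the set `E` with respect to `ν`. -/
def hbDim (ν : Measure ℝ) (E : Set ℝ) : ℝ≥0∞ :=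
  ⨅ (α : ℝ≥0) (_ : 0 < α) (_ : hbMeasure ν α E = 0), (α : ℝ≥0∞)

/-- The Hausdorff–Billingsley dimension of the measure `μ` with respect to the measure `ν`. -/
def hbDimMeasure (μ ν : Measure ℝ) : ℝ≥0∞ :=
  ⨅ (E : Set ℝ) (_ : MeasurableSet E) (_ : μ E = 1), hbDim ν E

/-- The distribution function `F`, with probability measure `F.measure`, preserves the
Hausdorff–Billingsley dimension (with respect to `γ`) on the set `A`. -/
def PreservesHBDim (F : StieltjesFunction ℝ) (γ : Measure ℝ) (A : Set ℝ) : Prop :=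
  ∀ E : Set ℝ, E ⊆ A → hbDim F.measure E = hbDim γ E

/-- The entropy of the `k`-th digit. -/
def digitEntropy (p : Fin 2 → ℕ → ℝ) (k : ℕ) : ℝ :=
  -(p 0 k * Real.log (p 0 k) + p 1 k * Real.log (p 1 k))

/-- The sum `H_n` of the first `n` entropies. -/
def entropySum (p : Fin 2 → ℕ → ℝ) (n : ℕ) : ℝ :=
  ∑ k ∈ Finset.range n, digitEntropy p k

open Classical in
/-- The number `g_n` of positive elements among the first `n` entropies. -/
def positiveEntropyCount (p : Fin 2 → ℕ → ℝ) (n : ℕ) : ℕ :=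
  ((Finset.range n).filter fun k => 0 < digitEntropy p k).card

end

/-! All digit probabilities lie in `(p₀, 1 - p₀)`, so `ν` is the fair-coin case and `g_n = n`. The
growth of `q` gives the cylinders disjoint nested hulls; one of rank `n` has `ν`-mass `2⁻ⁿ` and
`μ`-mass the product of its digit probabilities. The theorem follows from a cycle of three
implications.

Preservation gives dimension one: a set of full `μ`-measure has dimension at least one with respect
to `μ` (`one_le_hbDim_self`), hence with respect to `ν`. The bound `dim ≤ 1` is the case `t = 1` of
`IsBernoulliSeq.hbDimMeasure_le`.

Dimension one forces liminf one: if `H_n ≤ t n log 2` for infinitely many `n`, Chebyshev's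
inequality shows that at those ranks `μ` concentrates on cylinders of mass at least `2^(-sn)`, for
any `s > t`. There are at most `2^(sn)` of these, so the dimension is at most any `α > s`.

Liminf one gives preservation: by a Pinsker inequality the entropy deficit `log 2 - h_k` dominates
`(2 p_{ik} - 1)²`. Vanishing mean deficit therefore makes `∑ |log (2 p_{ik})|` be `o(n)` uniformly
over words, so the `μ`- and `ν`-masses of cylinders agree up to exponents `1 + o(1)`.
`IsBernoulliSeq.exists_map_Icc_le` carries this to intervals, and then all dimensions agree. -/

/-! ### Nested, separated hulls of cylinders. -/

section Geometry

/-- The deviation of the `k`-th term of the incomplete sum from the mean of its two values. -/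
noncomputable def digitDeviation (q : ℕ → ℕ) (x : ℕ → Fin 2) (k : ℕ) : ℝ :=
  (-1 : ℝ) ^ k * (((x k : ℕ) : ℝ) - 1 / 2) / (q k : ℝ)

/-- The centre of the hull of the cylinder of rank `n` around `x`. -/
noncomputable def cylinderCenter (q : ℕ → ℕ) (x : ℕ → Fin 2) (n : ℕ) : ℝ :=
  (∑' k : ℕ, (-1 : ℝ) ^ k / (2 * (q k : ℝ))) + ∑ k ∈ Finset.range n, digitDeviation q x k

/-- An upper bound for the radius of the cylinders of rank `n`, small enough to keep them apart. -/
noncomputable def cylinderRadius (q : ℕ → ℕ) (n : ℕ) : ℝ :=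
  (1 + 2 / ((q n : ℝ) + 1)) / (2 * (q n : ℝ))

/-- A closed interval that contains exactly those incomplete sums whose first `n` digits are those
of `x`. -/
noncomputable def cylinderHull (q : ℕ → ℕ) (x : ℕ → Fin 2) (n : ℕ) : Set ℝ :=
  Set.Icc (cylinderCenter q x n - cylinderRadius q n) (cylinderCenter q x n + cylinderRadius q n)

variable {q : ℕ → ℕ}

lemma abs_digitDeviation (x : ℕ → Fin 2) (k : ℕ) :
    |digitDeviation q x k| = 1 / (2 * (q k : ℝ)) := by
  have h : |((x k : ℕ) : ℝ) - 1 / 2| = 1 / 2 := by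
    rcases Fin.exists_fin_two.mp ⟨x k, rfl⟩ with h | h <;> rw [h] <;> norm_num
  rw [digitDeviation, abs_div, abs_mul, abs_pow, h]
  simp
  ring

lemma cylinderRadius_nonneg (n : ℕ) : 0 ≤ cylinderRadius q n := by
  unfold cylinderRadius; positivity

lemma IsSecondOstrogradsky.two_le (hq : IsSecondOstrogradsky q) (n : ℕ) : 2 ≤ q (n + 1) := by
  have h1 := hq.1 n
  have h2 := hq.2 n
  nlinarith

/-- With `c` in place of the 2 in `1 + 2 / (q n + 1)`, nesting of hulls needs `1 + c/3 ≤ c` and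
separation at `q n = 1` needs `1 + c/3 < 2`; the choice `c = 2` meets both, and `5/3 = 1 + c/3`. -/
lemma IsSecondOstrogradsky.radius_succ_le (hq : IsSecondOstrogradsky q) (n : ℕ) :
    cylinderRadius q (n + 1) ≤ (5 / 3) / (2 * ((q n : ℝ) * (q n + 1))) := by
  have h1 : (1 : ℝ) ≤ q n := by exact_mod_cast hq.1 n
  have h2 : (q n : ℝ) * (q n + 1) ≤ q (n + 1) := by exact_mod_cast hq.2 n
  have h3 : (2 : ℝ) ≤ q (n + 1) := by exact_mod_cast hq.two_le n
  unfold cylinderRadius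
  have h4 : 2 / ((q (n + 1) : ℝ) + 1) ≤ 2 / 3 := by
    apply div_le_div_of_nonneg_left <;> linarith
  gcongr
  linarith

lemma IsSecondOstrogradsky.radius_succ_lt (hq : IsSecondOstrogradsky q) (n : ℕ) :
    cylinderRadius q (n + 1) < 1 / (2 * (q n : ℝ)) := by
  have h1 : (1 : ℝ) ≤ q n := by exact_mod_cast hq.1 n
  refine (hq.radius_succ_le n).trans_lt ?_
  rw [div_lt_div_iff₀ (by positivity) (by positivity)]
  nlinarith

lemma IsSecondOstrogradsky.add_radius_succ_le (hq : IsSecondOstrogradsky q) (n : ℕ) :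
    1 / (2 * (q n : ℝ)) + cylinderRadius q (n + 1) ≤ cylinderRadius q n := by
  have h1 : (1 : ℝ) ≤ q n := by exact_mod_cast hq.1 n
  have h2 : cylinderRadius q n = 1 / (2 * (q n : ℝ)) + 2 / (2 * ((q n : ℝ) * (q n + 1))) := by
    unfold cylinderRadius; field_simp
  rw [h2]
  have h3 := hq.radius_succ_le n
  have : (5 / 3) / (2 * ((q n : ℝ) * (q n + 1))) ≤ 2 / (2 * ((q n : ℝ) * (q n + 1))) := by
    gcongr; norm_num
  linarith

lemma IsSecondOstrogradsky.summable (hq : IsSecondOstrogradsky q) :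
    Summable fun k => 1 / (2 * (q k : ℝ)) := by
  refine summable_of_sum_range_le (c := cylinderRadius q 0) (fun k => by positivity) fun n => ?_
  -- The radii telescope: each drop in radius pays for one term.
  have : ∑ i ∈ Finset.range n, 1 / (2 * (q i : ℝ)) ≤
      cylinderRadius q 0 - cylinderRadius q n := by
    induction n with
    | zero => simp
    | succ n ih => rw [Finset.sum_range_succ]; linarith [hq.add_radius_succ_le n]
  linarith [cylinderRadius_nonneg (q := q) n]

lemma IsSecondOstrogradsky.summable_digitDeviation (hq : IsSecondOstrogradsky q)
    (x : ℕ → Fin 2) : Summable (digitDeviation q x) :=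
  Summable.of_norm_bounded hq.summable fun k => (abs_digitDeviation x k).le

/-- Writing a digit as `1/2` plus a deviation makes every deviation equal to `± 1 / (2 q_k)`, so the
alternating signs no longer matter. -/
lemma IsSecondOstrogradsky.hasSum (hq : IsSecondOstrogradsky q) (x : ℕ → Fin 2) :
    HasSum (fun k => (-1 : ℝ) ^ k * ((x k : ℕ) : ℝ) / (q k : ℝ))
      ((∑' k : ℕ, (-1 : ℝ) ^ k / (2 * (q k : ℝ))) + ∑' k, digitDeviation q x k) := by
  have h1 : Summable fun k => (-1 : ℝ) ^ k / (2 * (q k : ℝ)) := by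
    refine Summable.of_norm_bounded hq.summable fun k => le_of_eq ?_
    rw [Real.norm_eq_abs, abs_div, abs_pow]
    simp
  convert h1.hasSum.add (hq.summable_digitDeviation x).hasSum using 2 with k
  unfold digitDeviation
  have : (q k : ℝ) ≠ 0 := by exact_mod_cast (hq.1 k).ne'
  field_simp
  ring

lemma abs_cylinderCenter_succ_sub (x : ℕ → Fin 2) (n : ℕ) :
    |cylinderCenter q x (n + 1) - cylinderCenter q x n| = 1 / (2 * (q n : ℝ)) := by
  rw [← abs_digitDeviation x n, cylinderCenter, cylinderCenter, Finset.sum_range_succ]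
  congr 1; ring

lemma IsSecondOstrogradsky.cylinderHull_succ_subset (hq : IsSecondOstrogradsky q)
    (x : ℕ → Fin 2) (n : ℕ) : cylinderHull q x (n + 1) ⊆ cylinderHull q x n := by
  have h1 := abs_le.mp (abs_cylinderCenter_succ_sub (q := q) x n).le
  have h2 := hq.add_radius_succ_le n
  exact Set.Icc_subset_Icc (by linarith) (by linarith)

lemma IsSecondOstrogradsky.cylinderHull_antitone (hq : IsSecondOstrogradsky q)
    (x : ℕ → Fin 2) : Antitone (cylinderHull q x) :=
  antitone_nat_of_succ_le (hq.cylinderHull_succ_subset x)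

lemma measurableSet_cylinderHull (x : ℕ → Fin 2) (n : ℕ) : MeasurableSet (cylinderHull q x n) :=
  measurableSet_Icc

lemma cylinderCenter_mem (x : ℕ → Fin 2) (n : ℕ) : cylinderCenter q x n ∈ cylinderHull q x n := by
  have := cylinderRadius_nonneg (q := q) n
  constructor <;> linarith

lemma IsSecondOstrogradsky.tsum_mem_cylinderHull (hq : IsSecondOstrogradsky q)
    (x : ℕ → Fin 2) (n : ℕ) :
    ∑' k, (-1 : ℝ) ^ k * ((x k : ℕ) : ℝ) / (q k : ℝ) ∈ cylinderHull q x n := by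
  rw [(hq.hasSum x).tsum_eq]
  have h : Tendsto (cylinderCenter q x) atTop
      (nhds ((∑' k : ℕ, (-1 : ℝ) ^ k / (2 * (q k : ℝ))) + ∑' k, digitDeviation q x k)) :=
    (hq.summable_digitDeviation x).hasSum.tendsto_sum_nat.const_add _
  refine isClosed_Icc.mem_of_tendsto h ?_
  filter_upwards [eventually_ge_atTop n] with m hm
  exact hq.cylinderHull_antitone x hm (cylinderCenter_mem x m)

lemma cylinderCenter_congr {x y : ℕ → Fin 2} {n : ℕ} (h : ∀ k < n, x k = y k) :
    cylinderCenter q x n = cylinderCenter q y n := by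
  unfold cylinderCenter
  congr 1
  refine Finset.sum_congr rfl fun k hk => ?_
  rw [digitDeviation, digitDeviation, h k (Finset.mem_range.mp hk)]

lemma cylinderHull_congr {x y : ℕ → Fin 2} {n : ℕ} (h : ∀ k < n, x k = y k) :
    cylinderHull q x n = cylinderHull q y n := by
  rw [cylinderHull, cylinderHull, cylinderCenter_congr h]

/-- At the first differing digit `k` the two centres are `1 / q k` apart, while both radii are below
`1 / (2 q k)`; a common point is impossible. -/
lemma IsSecondOstrogradsky.eq_of_mem_cylinderHull (hq : IsSecondOstrogradsky q)
    {x y : ℕ → Fin 2} {n : ℕ} {t : ℝ} (hx : t ∈ cylinderHull q x n) (hy : t ∈ cylinderHull q y n) :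
    ∀ k < n, x k = y k := by
  intro k
  induction k using Nat.strong_induction_on with
  | _ k ih =>
  intro hk
  by_contra hne
  have hx' := hq.cylinderHull_antitone x (Nat.succ_le_of_lt hk) hx
  have hy' := hq.cylinderHull_antitone y (Nat.succ_le_of_lt hk) hy
  have hc : cylinderCenter q x k = cylinderCenter q y k :=
    cylinderCenter_congr fun j hj => ih j hj (hj.trans hk)
  have hs (z : ℕ → Fin 2) :
      cylinderCenter q z (k + 1) = cylinderCenter q z k + digitDeviation q z k := by
    rw [cylinderCenter, cylinderCenter, Finset.sum_range_succ]; ring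
  have hd : digitDeviation q x k = -digitDeviation q y k := by
    have : ((x k : ℕ) : ℝ) - 1 / 2 = -(((y k : ℕ) : ℝ) - 1 / 2) := by
      generalize x k = a at *
      generalize y k = b at *
      fin_cases a <;> fin_cases b <;> simp_all <;> norm_num
    rw [digitDeviation, digitDeviation, this]; ring
  have ha := abs_digitDeviation (q := q) y k
  have hr := hq.radius_succ_lt k
  simp only [Nat.succ_eq_add_one, cylinderHull, Set.mem_Icc, hs] at hx' hy'
  rcases abs_cases (digitDeviation q y k) with ⟨h, -⟩ | ⟨h, -⟩ <;> linarith [hx'.1, hx'.2, hy'.1, hy'.2]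

lemma IsSecondOstrogradsky.tsum_mem_cylinderHull_iff (hq : IsSecondOstrogradsky q)
    (x y : ℕ → Fin 2) (n : ℕ) :
    ∑' k, (-1 : ℝ) ^ k * ((y k : ℕ) : ℝ) / (q k : ℝ) ∈ cylinderHull q x n ↔
      ∀ k < n, y k = x k := by
  refine ⟨fun h => hq.eq_of_mem_cylinderHull (hq.tsum_mem_cylinderHull y n) h, fun h => ?_⟩
  rw [← cylinderHull_congr h]
  exact hq.tsum_mem_cylinderHull y n

/-- An interval that meets `Icc c d` and is not contained in it contains one of its endpoints. -/
lemma Set.OrdConnected.mem_or_mem_of_not_subset_Icc {s : Set ℝ} (hs : s.OrdConnected) {c d t : ℝ}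
    (ht : t ∈ s) (htI : t ∈ Set.Icc c d) (h : ¬ s ⊆ Set.Icc c d) : c ∈ s ∨ d ∈ s := by
  obtain ⟨u, hu, huI⟩ := Set.not_subset.mp h
  rcases lt_or_ge u c with h1 | h1
  · exact .inl (hs.out hu ht ⟨h1.le, htI.1⟩)
  · have : d < u := by
      by_contra h2
      exact huI ⟨h1, not_lt.mp h2⟩
    exact .inr (hs.out ht hu ⟨htI.2, this.le⟩)

end Geometry

/-! ### Masses of cylinders and intervals. -/

section Probability

/-- The probability of the digits of `x` up to rank `n`. -/
noncomputable def cylinderProb (p : Fin 2 → ℕ → ℝ) (x : ℕ → Fin 2) (n : ℕ) : ℝ :=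
  ∏ k ∈ Finset.range n, p (x k) k

variable {Ω : Type*} [MeasurableSpace Ω] {P : Measure Ω} {q : ℕ → ℕ} {p : Fin 2 → ℕ → ℝ}
  {ξ : ℕ → Ω → Fin 2}

lemma IsBernoulliSeq.measure_cylinder (hξ : IsBernoulliSeq P p ξ) (hp : ∀ i k, 0 ≤ p i k)
    (x : ℕ → Fin 2) (n : ℕ) :
    P {ω | ∀ k < n, ξ k ω = x k} = ENNReal.ofReal (cylinderProb p x n) := by
  have h := hξ.indep.measure_inter_preimage_eq_mul (Finset.range n) (sets := fun k => {x k})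
    fun k _ => measurableSet_singleton _
  rw [cylinderProb, ENNReal.ofReal_prod_of_nonneg fun k _ => hp _ _]
  convert h using 2 with k
  · ext ω; simp
  · exact (hξ.prob (x _) _).symm

lemma IsBernoulliSeq.measurable_ostrogradskySum (hξ : IsBernoulliSeq P p ξ) :
    Measurable (ostrogradskySum q ξ) := by
  unfold ostrogradskySum
  refine Measurable.tsum fun k => ?_
  have : Measurable fun i : Fin 2 => ((i : ℕ) : ℝ) := measurable_of_finite _
  exact ((this.comp (hξ.measurable k)).const_mul _).div_const _

lemma IsBernoulliSeq.map_cylinderHull (hξ : IsBernoulliSeq P p ξ) (hq : IsSecondOstrogradsky q)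
    (hp : ∀ i k, 0 ≤ p i k) (x : ℕ → Fin 2) (n : ℕ) :
    P.map (ostrogradskySum q ξ) (cylinderHull q x n) = ENNReal.ofReal (cylinderProb p x n) := by
  rw [Measure.map_apply hξ.measurable_ostrogradskySum
    (measurableSet_cylinderHull x n), ← hξ.measure_cylinder hp x n]
  congr 1
  ext ω
  exact hq.tsum_mem_cylinderHull_iff x (fun k => ξ k ω) n

/-- Every rank-`n` hull that meets the interval sticks out of it and so contains `c` or `d`. Each
endpoint lies in at most one hull, whence the factor 2. -/
lemma IsBernoulliSeq.map_Icc_le (hξ : IsBernoulliSeq P p ξ) (hq : IsSecondOstrogradsky q)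
    (hp : ∀ i k, 0 ≤ p i k) {c d : ℝ} {n : ℕ} (h : ∀ x, ¬ cylinderHull q x n ⊆ Set.Icc c d)
    {M : ℝ≥0∞} (hM : ∀ x, ENNReal.ofReal (cylinderProb p x n) ≤ M) :
    P.map (ostrogradskySum q ξ) (Set.Icc c d) ≤ 2 * M := by
  have key (t : ℝ) : P {ω | t ∈ cylinderHull q (fun k => ξ k ω) n} ≤ M := by
    rcases Set.eq_empty_or_nonempty {ω | t ∈ cylinderHull q (fun k => ξ k ω) n} with h0 | ⟨ω₀, h0⟩
    · simp [h0]
    · refine le_trans (measure_mono fun ω hω => ?_)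
        ((hξ.measure_cylinder hp (fun k => ξ k ω₀) n).le.trans (hM _))
      exact hq.eq_of_mem_cylinderHull hω h0
  rw [Measure.map_apply hξ.measurable_ostrogradskySum measurableSet_Icc, two_mul]
  refine le_trans (measure_mono fun ω hω => ?_)
    ((measure_union_le _ _).trans (add_le_add (key c) (key d)))
  exact Set.OrdConnected.mem_or_mem_of_not_subset_Icc Set.ordConnected_Icc
    (hq.tsum_mem_cylinderHull (fun k => ξ k ω) n) hω (h _)

end Probability

/-! ### Hausdorff–Billingsley measure and dimension. -/

section HausdorffBillingsley

/-- For null sets the size restriction is automatic: a sum at most `ε ^ α` bounds each term by `ε ^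
α`. -/
lemma hbMeasure_eq_zero_iff {ν : Measure ℝ} {α : ℝ≥0} (hα : 0 < α) {E : Set ℝ} :
    hbMeasure ν α E = 0 ↔ ∀ η : ℝ≥0∞, 0 < η → ∃ c d : ℕ → ℝ,
      E ⊆ ⋃ j, Set.Icc (c j) (d j) ∧ ∑' j, ν (Set.Icc (c j) (d j)) ^ (α : ℝ) ≤ η := by
  have hα' : (0 : ℝ) < α := hα
  constructor
  · intro h η hη
    have h1 : hbPremeasure ν α 1 E < η := by
      refine lt_of_le_of_lt ?_ hη
      rw [← h]
      exact le_iSup₂ (f := fun (ε : ℝ≥0∞) (_ : 0 < ε) => hbPremeasure ν α ε E) 1 one_pos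
    simp only [hbPremeasure, iInf_lt_iff] at h1
    obtain ⟨c, d, hE, -, hs⟩ := h1
    exact ⟨c, d, hE, hs.le⟩
  · intro h
    refine le_antisymm (iSup₂_le fun ε hε => ?_) zero_le
    refine le_of_forall_pos_le_add fun η hη => ?_
    rw [zero_add]
    have hpos : 0 < min η (ε ^ (α : ℝ)) := by
      refine lt_min hη ?_
      rcases eq_or_ne ε ⊤ with rfl | hε'
      · simp [ENNReal.top_rpow_of_pos hα']
      · exact ENNReal.rpow_pos hε hε'
    obtain ⟨c, d, hE, hs⟩ := h _ hpos
    refine iInf_le_of_le c (iInf_le_of_le d (iInf_le_of_le hE (iInf_le_of_le (fun j => ?_)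
      (hs.trans (min_le_left _ _)))))
    have h1 : ν (Set.Icc (c j) (d j)) ^ (α : ℝ) ≤ ε ^ (α : ℝ) :=
      (ENNReal.le_tsum j).trans (hs.trans (min_le_right _ _))
    exact (ENNReal.rpow_le_rpow_iff hα').mp h1

lemma hbDim_mono (ν : Measure ℝ) {E E' : Set ℝ} (h : E ⊆ E') : hbDim ν E ≤ hbDim ν E' := by
  refine le_iInf₂ fun α hα => le_iInf fun h0 => ?_
  refine iInf₂_le_of_le α hα (iInf_le _ ?_)
  rw [hbMeasure_eq_zero_iff hα] at h0 ⊢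
  intro η hη
  obtain ⟨c, d, hE, hs⟩ := h0 η hη
  exact ⟨c, d, h.trans hE, hs⟩

lemma hbDim_le_of_hbMeasure_eq_zero {ν : Measure ℝ} {α : ℝ≥0} (hα : 0 < α) {E : Set ℝ}
    (h : hbMeasure ν α E = 0) : hbDim ν E ≤ α :=
  iInf₂_le_of_le α hα (iInf_le _ h)

/-- For `α ≤ 1` and masses at most one, `μ(I) ≤ μ(I) ^ α`, so every covering sum is at least `μ E`.
-/
lemma one_le_hbDim_self {μ : Measure ℝ} [IsProbabilityMeasure μ] {E : Set ℝ} (hE : μ E = 1) :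
    1 ≤ hbDim μ E := by
  refine le_iInf₂ fun α hα => le_iInf fun h0 => ?_
  by_contra hlt
  have hα1 : (α : ℝ) ≤ 1 := by
    rw [not_le] at hlt
    exact_mod_cast hlt.le
  obtain ⟨c, d, hcov, hs⟩ := (hbMeasure_eq_zero_iff hα).mp h0 2⁻¹ (by simp)
  have : (1 : ℝ≥0∞) ≤ 2⁻¹ := by
    calc (1 : ℝ≥0∞) = μ E := hE.symm
      _ ≤ ∑' j, μ (Set.Icc (c j) (d j)) := (measure_mono hcov).trans (measure_iUnion_le _)
      _ ≤ ∑' j, μ (Set.Icc (c j) (d j)) ^ (α : ℝ) := by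
          refine ENNReal.tsum_le_tsum fun j => ?_
          conv_lhs => rw [← ENNReal.rpow_one (μ (Set.Icc (c j) (d j)))]
          exact ENNReal.rpow_le_rpow_of_exponent_ge prob_le_one hα1
      _ ≤ 2⁻¹ := hs
  have h2 : (2⁻¹ : ℝ≥0∞) < 1 := by simp [ENNReal.inv_lt_one]
  exact absurd this (not_le.mpr h2)

lemma hbMeasure_eq_zero_of_Icc_le {μ ν : Measure ℝ} {C : ℝ≥0} {s : ℝ≥0} (hs : 0 < s)
    (h : ∀ c d, μ (Set.Icc c d) ≤ C * ν (Set.Icc c d) ^ (s : ℝ)) {α : ℝ≥0} (hα : 0 < α)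
    {E : Set ℝ} (h0 : hbMeasure ν α E = 0) : hbMeasure μ (α / s) E = 0 := by
  have hs' : (0 : ℝ) < s := hs
  rw [hbMeasure_eq_zero_iff (div_pos hα hs)]
  rw [hbMeasure_eq_zero_iff hα] at h0
  intro η hη
  set A : ℝ≥0∞ := (C : ℝ≥0∞) ^ ((α / s : ℝ≥0) : ℝ) with hA
  have hAtop : A ≠ ⊤ := by
    rw [hA]; exact ENNReal.rpow_ne_top_of_nonneg (by positivity) ENNReal.coe_ne_top
  -- The denominator is `A + 1` because `A` vanishes when `C = 0`.
  obtain ⟨c, d, hE, hsum⟩ := h0 (η / (A + 1)) (ENNReal.div_pos hη.ne' (by simp [hAtop]))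
  refine ⟨c, d, hE, ?_⟩
  calc ∑' j, μ (Set.Icc (c j) (d j)) ^ ((α / s : ℝ≥0) : ℝ)
      ≤ ∑' j, A * ν (Set.Icc (c j) (d j)) ^ (α : ℝ) := by
        refine ENNReal.tsum_le_tsum fun j => ?_
        refine (ENNReal.rpow_le_rpow (h _ _) (by positivity)).trans_eq ?_
        rw [ENNReal.mul_rpow_of_nonneg _ _ (by positivity), ← ENNReal.rpow_mul]
        congr 2
        push_cast
        field_simp
    _ = A * ∑' j, ν (Set.Icc (c j) (d j)) ^ (α : ℝ) := ENNReal.tsum_mul_left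
    _ ≤ (A + 1) * (η / (A + 1)) := by gcongr; simp
    _ ≤ η := ENNReal.mul_div_le

lemma hbDim_le_hbDim_of_Icc_le {μ ν : Measure ℝ}
    (h : ∀ s : ℝ≥0, 0 < s → s < 1 →
      ∃ C : ℝ≥0, ∀ c d, μ (Set.Icc c d) ≤ C * ν (Set.Icc c d) ^ (s : ℝ)) (E : Set ℝ) :
    hbDim μ E ≤ hbDim ν E := by
  refine le_iInf₂ fun α hα => le_iInf fun h0 => ?_
  refine ENNReal.le_of_forall_pos_le_add fun ε hε _ => ?_
  -- This `s` makes the resulting exponent `α / s` equal to `α + ε`.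
  have hs : 0 < α / (α + ε) := by positivity
  have hs1 : α / (α + ε) < 1 := by
    rw [div_lt_one (by positivity)]; exact lt_add_of_pos_right _ hε
  obtain ⟨C, hC⟩ := h _ hs hs1
  have := hbDim_le_of_hbMeasure_eq_zero (by positivity) (hbMeasure_eq_zero_of_Icc_le hs hC hα h0)
  refine this.trans_eq ?_
  rw [div_div_eq_mul_div, mul_div_cancel_left₀ _ hα.ne', ENNReal.coe_add]

lemma hbMeasure_eq_zero_of_countable_cover {ν : Measure ℝ} {α : ℝ≥0} (hα : 0 < α) {E : Set ℝ}
    (h : ∀ η : ℝ≥0∞, 0 < η → ∃ (ι : Type) (_ : Countable ι) (_ : Infinite ι) (c d : ι → ℝ),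
      E ⊆ ⋃ j, Set.Icc (c j) (d j) ∧ ∑' j, ν (Set.Icc (c j) (d j)) ^ (α : ℝ) ≤ η) :
    hbMeasure ν α E = 0 := by
  rw [hbMeasure_eq_zero_iff hα]
  intro η hη
  obtain ⟨ι, _, _, c, d, hE, hs⟩ := h η hη
  obtain ⟨e⟩ := nonempty_equiv_of_countable (α := ℕ) (β := ι)
  refine ⟨c ∘ e, d ∘ e, ?_, ?_⟩
  · intro t ht
    obtain ⟨j, hj⟩ := Set.mem_iUnion.mp (hE ht)
    exact Set.mem_iUnion.mpr ⟨e.symm j, by simpa using hj⟩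
  · exact (e.tsum_eq fun j => ν (Set.Icc (c j) (d j)) ^ (α : ℝ)).trans_le hs

end HausdorffBillingsley

/-! ### From comparing cylinders to comparing intervals. -/

section Comparison

lemma exp_sum_log_eq_cylinderProb {p : Fin 2 → ℕ → ℝ} (hp : ∀ i k, 0 < p i k) (x : ℕ → Fin 2)
    (n : ℕ) : Real.exp (∑ k ∈ Finset.range n, Real.log (p (x k) k)) = cylinderProb p x n := by
  rw [Real.exp_sum, cylinderProb]
  exact Finset.prod_congr rfl fun k _ => Real.exp_log (hp _ _)

variable {Ω Ω' : Type*} [MeasurableSpace Ω] [MeasurableSpace Ω'] {P : Measure Ω} {P' : Measure Ω'}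
  {q : ℕ → ℕ} {p p' : Fin 2 → ℕ → ℝ} {ξ : ℕ → Ω → Fin 2} {ξ' : ℕ → Ω' → Fin 2}

/-- Take the least rank `n + 1` at which the interval contains a hull: that hull bounds the second
mass from below, and the absence of hulls of rank `n` bounds the first from above. The words `x` and
`y` are unrelated, so the hypothesis must be uniform in both. -/
lemma IsBernoulliSeq.exists_map_Icc_le [IsProbabilityMeasure P] (hξ : IsBernoulliSeq P p ξ)
    (hξ' : IsBernoulliSeq P' p' ξ')
    (hq : IsSecondOstrogradsky q) (hp : ∀ i k, 0 < p i k) (hp' : ∀ i k, 0 < p' i k)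
    (hr : ∃ r < 1, ∀ i k, p i k ≤ r) {s : ℝ≥0}
    (h : ∃ b : ℝ, ∀ (n : ℕ) (x y : ℕ → Fin 2), ∑ k ∈ Finset.range n, Real.log (p (x k) k) ≤
      b + s * ∑ k ∈ Finset.range (n + 1), Real.log (p' (y k) k)) :
    ∃ C : ℝ≥0, ∀ c d, P.map (ostrogradskySum q ξ) (Set.Icc c d) ≤
      C * P'.map (ostrogradskySum q ξ') (Set.Icc c d) ^ (s : ℝ) := by
  obtain ⟨b, hb⟩ := h
  obtain ⟨r, hr1, hr⟩ := hr
  have : IsProbabilityMeasure (P.map (ostrogradskySum q ξ)) :=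
    Measure.isProbabilityMeasure_map hξ.measurable_ostrogradskySum.aemeasurable
  have hcomp (n x y) : ENNReal.ofReal (cylinderProb p x n) ≤
      ENNReal.ofReal (Real.exp |b|) * ENNReal.ofReal (cylinderProb p' y (n + 1)) ^ (s : ℝ) := by
    rw [← exp_sum_log_eq_cylinderProb hp, ← exp_sum_log_eq_cylinderProb hp',
      ENNReal.ofReal_rpow_of_nonneg (Real.exp_nonneg _) s.coe_nonneg,
      ← ENNReal.ofReal_mul (Real.exp_nonneg _), ← Real.exp_mul, ← Real.exp_add]
    refine ENNReal.ofReal_le_ofReal (Real.exp_le_exp.mpr ?_)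
    linarith [hb n x y, le_abs_self b]
  refine ⟨2 * (Real.exp |b|).toNNReal, fun c d => ?_⟩
  have hC : ((2 * (Real.exp |b|).toNNReal : ℝ≥0) : ℝ≥0∞) = 2 * ENNReal.ofReal (Real.exp |b|) := by
    push_cast; rfl
  rw [hC]
  by_cases hex : ∃ n x, cylinderHull q x n ⊆ Set.Icc c d
  · classical
    obtain ⟨x, hx⟩ := Nat.find_spec hex
    have hmin := fun m (hm : m < Nat.find hex) => not_exists.mp (Nat.find_min hex hm)
    generalize Nat.find hex = n at hx hmin
    have hle := measure_mono (μ := P'.map (ostrogradskySum q ξ')) hx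
    rw [hξ'.map_cylinderHull hq fun i k => (hp' i k).le] at hle
    cases n with
    -- The hull of rank 0 carries the full mass, so the right side is at least one.
    | zero =>
      simp only [cylinderProb, Finset.range_zero, Finset.prod_empty, ENNReal.ofReal_one] at hle
      calc P.map (ostrogradskySum q ξ) (Set.Icc c d) ≤ 1 * 1 * 1 := by
            simpa using prob_le_one
        _ ≤ _ := by
            gcongr
            · norm_num
            · exact ENNReal.one_le_ofReal.mpr (Real.one_le_exp (abs_nonneg b))
            · simpa using ENNReal.rpow_le_rpow hle s.coe_nonneg
    | succ m =>
      refine (hξ.map_Icc_le hq (fun i k => (hp i k).le) (hmin m (Nat.lt_succ_self m))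
        fun y => hcomp m y x).trans ?_
      rw [mul_assoc]
      gcongr
  -- An interval containing no hull of any rank has mass at most `2 rⁿ` for every `n`, hence zero.
  · push Not at hex
    have h0 : Tendsto (fun n : ℕ => 2 * ENNReal.ofReal (r ^ n)) atTop (nhds (2 * 0)) := by
      have hr0 : 0 ≤ r := (hp 0 0).le.trans (hr 0 0)
      refine ENNReal.Tendsto.const_mul ?_ (by simp)
      simpa using ENNReal.tendsto_ofReal (tendsto_pow_atTop_nhds_zero_of_lt_one hr0 hr1)
    have hz : P.map (ostrogradskySum q ξ) (Set.Icc c d) ≤ 2 * 0 := by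
      refine ge_of_tendsto' h0 fun n => ?_
      refine hξ.map_Icc_le hq (fun i k => (hp i k).le) (hex n) fun x =>
        ENNReal.ofReal_le_ofReal ?_
      exact (Finset.prod_le_prod (fun k _ => (hp _ _).le) fun k _ => hr _ _).trans_eq (by simp)
    rw [mul_zero] at hz
    exact hz.trans zero_le

end Comparison

/-! ### Entropy deficit and deviation from the fair coin. -/

section Entropy

lemma sq_sub_one_div_le {x : ℝ} (hx : 0 < x) :
    (x - 1) ^ 2 / (2 * x + 2) ≤ x * Real.log x - x + 1 := by
  -- With `y = √x`, the bound `log y ≥ 1 - 1/y` gives `x log x - x + 1 ≥ (y - 1)²`, and `(y + 1)² ≤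
  -- 2y² + 2`.
  obtain ⟨y, hy, rfl⟩ : ∃ y : ℝ, 0 < y ∧ x = y ^ 2 := ⟨√x, Real.sqrt_pos.mpr hx, by
    rw [Real.sq_sqrt hx.le]⟩
  have h1 := Real.one_sub_inv_le_log_of_pos hy
  have h2 : 2 * y ^ 2 - 2 * y ≤ y ^ 2 * Real.log (y ^ 2) := by
    rw [Real.log_pow]
    have : y ^ 2 * (1 - y⁻¹) = y ^ 2 - y := by field_simp
    push_cast
    nlinarith [mul_le_mul_of_nonneg_left h1 (sq_nonneg y)]
  rw [div_le_iff₀ (by positivity)]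
  have h3 : (y ^ 2 - 1) ^ 2 ≤ (y - 1) ^ 2 * (2 * y ^ 2 + 2) := by
    nlinarith [mul_nonneg (sq_nonneg (y - 1)) (sq_nonneg (y - 1))]
  refine h3.trans ?_
  gcongr
  linarith

/-- A form of Pinsker's inequality for two-point distributions. -/
lemma sq_le_log_two_add_mul_log {a b : ℝ} (ha : 0 < a) (hb : 0 < b) (hab : a + b = 1) :
    (2 * a - 1) ^ 2 / 6 ≤ Real.log 2 + (a * Real.log a + b * Real.log b) := by
  -- Added over `c = a` and `c = b`, the terms `-2c + 1` cancel, as `a + b = 1`.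
  have key (c : ℝ) (hc : 0 < c) (hc1 : c < 1) :
      (2 * c - 1) ^ 2 / 6 ≤ 2 * c * (Real.log 2 + Real.log c) - 2 * c + 1 := by
    have h := sq_sub_one_div_le (x := 2 * c) (by positivity)
    rw [Real.log_mul (by norm_num) hc.ne'] at h
    refine le_trans ?_ h
    apply div_le_div_of_nonneg_left <;> nlinarith
  have h1 := key a ha (by linarith)
  have h2 := key b hb (by linarith)
  obtain rfl : b = 1 - a := by linarith
  nlinarith

lemma abs_log_le_div {u m : ℝ} (hm : 0 < m) (hm1 : m ≤ 1) (hu : m ≤ u) :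
    |Real.log u| ≤ |u - 1| / m := by
  have hu0 : 0 < u := hm.trans_le hu
  have h1 := Real.log_le_sub_one_of_pos hu0
  have h2 := Real.one_sub_inv_le_log_of_pos hu0
  rw [le_div_iff₀ hm]
  rcases le_total 1 u with h | h
  · rw [abs_of_nonneg (Real.log_nonneg h), abs_of_nonneg (by linarith)]
    nlinarith [Real.log_nonneg h]
  · rw [abs_of_nonpos (Real.log_nonpos hu0.le h), abs_of_nonpos (by linarith)]
    have h3 : -Real.log u * u ≤ 1 - u := by
      have : (1 - u⁻¹) * u = u - 1 := by field_simp
      nlinarith [mul_le_mul_of_nonneg_right h2 hu0.le]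
    nlinarith [Real.log_nonpos hu0.le h]

variable {p : Fin 2 → ℕ → ℝ}

lemma digitEntropy_le_log_two (hsum : ∀ k, p 0 k + p 1 k = 1) (hp : ∀ i k, 0 < p i k) (k : ℕ) :
    digitEntropy p k ≤ Real.log 2 := by
  have := sq_le_log_two_add_mul_log (hp 0 k) (hp 1 k) (hsum k)
  unfold digitEntropy
  nlinarith [sq_nonneg (2 * p 0 k - 1)]

/-- The logarithm is linear in `|2p - 1|` but the deficit only controls its square; `t ≤ δ + t² /
(4δ)` bridges the two at the cost of `δ`. -/
lemma exists_abs_log_two_mul_le (hsum : ∀ k, p 0 k + p 1 k = 1) {p₀ : ℝ} (hp₀ : 0 < p₀)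
    (hp : ∀ i k, p₀ < p i k) {δ : ℝ} (hδ : 0 < δ) :
    ∃ K : ℝ, 0 < K ∧ ∀ i k,
      |Real.log (2 * p i k)| ≤ δ + K * (Real.log 2 - digitEntropy p k) := by
  have hp₀' : 2 * p₀ ≤ 1 := by linarith [hp 0 0, hp 1 0, hsum 0]
  refine ⟨6 / (16 * δ * p₀ ^ 2), by positivity, fun i k => ?_⟩
  have h1 : (2 * p i k - 1) ^ 2 / 6 ≤ Real.log 2 - digitEntropy p k := by
    have := sq_le_log_two_add_mul_log (hp₀.trans (hp 0 k)) (hp₀.trans (hp 1 k)) (hsum k)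
    unfold digitEntropy
    have h01 : p 1 k = 1 - p 0 k := by linarith [hsum k]
    fin_cases i
    · simp only [Fin.zero_eta]; linarith
    · simp only [Fin.mk_one]
      have : (2 * p 1 k - 1) ^ 2 = (2 * p 0 k - 1) ^ 2 := by rw [h01]; ring
      rw [this]; linarith
  have h2 := abs_log_le_div (by positivity) hp₀' (by linarith [hp i k] : 2 * p₀ ≤ 2 * p i k)
  set t := |2 * p i k - 1| / (2 * p₀) with ht
  have h3 : t ≤ δ + t ^ 2 / (4 * δ) := by
    have : 0 ≤ (t - 2 * δ) ^ 2 / (4 * δ) := by positivity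
    have h' : (t - 2 * δ) ^ 2 / (4 * δ) = t ^ 2 / (4 * δ) - t + δ := by field_simp; ring
    linarith
  have h4 : t ^ 2 / (4 * δ) = 6 / (16 * δ * p₀ ^ 2) * ((2 * p i k - 1) ^ 2 / 6) := by
    rw [ht, div_pow, sq_abs]; field_simp; ring
  have h5 : 6 / (16 * δ * p₀ ^ 2) * ((2 * p i k - 1) ^ 2 / 6) ≤
      6 / (16 * δ * p₀ ^ 2) * (Real.log 2 - digitEntropy p k) := by gcongr
  linarith

lemma exists_abs_sum_log_two_mul_le (hsum : ∀ k, p 0 k + p 1 k = 1) {p₀ : ℝ} (hp₀ : 0 < p₀)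
    (hp : ∀ i k, p₀ < p i k)
    (hH : ∀ η > 0, ∀ᶠ n : ℕ in atTop, n * Real.log 2 - entropySum p n ≤ η * n)
    {δ : ℝ} (hδ : 0 < δ) :
    ∃ A : ℝ, ∀ (n : ℕ) (x : ℕ → Fin 2),
      |∑ k ∈ Finset.range n, Real.log (2 * p (x k) k)| ≤ A + δ * n := by
  obtain ⟨K, hK, hKle⟩ := exists_abs_log_two_mul_le hsum hp₀ hp (half_pos hδ)
  obtain ⟨N, hN⟩ := eventually_atTop.mp (hH (δ / (2 * K)) (by positivity))
  refine ⟨K * (δ / (2 * K) * N), fun n x => ?_⟩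
  have hD (m : ℕ) : ∑ k ∈ Finset.range m, (Real.log 2 - digitEntropy p k) =
      m * Real.log 2 - entropySum p m := by
    simp [entropySum, Finset.sum_sub_distrib]
  calc |∑ k ∈ Finset.range n, Real.log (2 * p (x k) k)|
      ≤ ∑ k ∈ Finset.range n, |Real.log (2 * p (x k) k)| := Finset.abs_sum_le_sum_abs _ _
    _ ≤ ∑ k ∈ Finset.range n, (δ / 2 + K * (Real.log 2 - digitEntropy p k)) :=
        Finset.sum_le_sum fun k _ => hKle _ _
    _ = δ / 2 * n + K * ∑ k ∈ Finset.range n, (Real.log 2 - digitEntropy p k) := by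
        rw [Finset.sum_add_distrib, ← Finset.mul_sum]; simp; ring
    _ ≤ δ / 2 * n + K * (δ / (2 * K) * (n + N)) := by
        gcongr
        -- Deficits are nonnegative, so lengthening the sum to `n + N ≥ N` makes the eventual bound
        -- available for every `n`.
        calc ∑ k ∈ Finset.range n, (Real.log 2 - digitEntropy p k)
            ≤ ∑ k ∈ Finset.range (n + N), (Real.log 2 - digitEntropy p k) := by
              refine Finset.sum_le_sum_of_subset_of_nonneg
                (Finset.range_mono (Nat.le_add_right n N)) fun k _ _ => ?_
              linarith [digitEntropy_le_log_two hsum (fun i k => hp₀.trans (hp i k)) k]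
          _ ≤ δ / (2 * K) * (n + N) := by
              rw [hD]
              exact_mod_cast hN (n + N) (Nat.le_add_left N n)
    _ = K * (δ / (2 * K) * N) + δ * n := by field_simp; ring

end Entropy

/-! ### Upper bound for the dimension of `μ`. -/

section UpperBound

variable {Ω Ω' : Type*} [MeasurableSpace Ω] [MeasurableSpace Ω'] {P : Measure Ω} {P' : Measure Ω'}
  {q : ℕ → ℕ} {p p' : Fin 2 → ℕ → ℝ} {ξ : ℕ → Ω → Fin 2} {ξ' : ℕ → Ω' → Fin 2}

lemma IsBernoulliSeq.integral_neg_log (hξ : IsBernoulliSeq P p ξ) (hp : ∀ i k, 0 < p i k) (k : ℕ)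
    [IsProbabilityMeasure P] : ∫ ω, -Real.log (p (ξ k ω) k) ∂P = digitEntropy p k := by
  have := Measure.isProbabilityMeasure_map (μ := P) (hξ.measurable k).aemeasurable
  have h := integral_map (μ := P) (hξ.measurable k).aemeasurable
    (f := fun i => -Real.log (p i k)) (measurable_of_finite _).aestronglyMeasurable
  rw [← h, integral_fintype (Integrable.of_finite)]
  have hm (i : Fin 2) : (P.map (ξ k)).real {i} = p i k := by
    rw [Measure.real, Measure.map_apply (hξ.measurable k) (measurableSet_singleton i)]
    have : ξ k ⁻¹' {i} = {ω | ξ k ω = i} := rfl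
    rw [this, hξ.prob, ENNReal.toReal_ofReal (hp i k).le]
  simp only [Fin.sum_univ_two, hm, digitEntropy, smul_eq_mul]
  ring

/-- Chebyshev's inequality for independent terms whose means are the digit entropies and whose
values lie in `[0, -log p₀]`. -/
lemma IsBernoulliSeq.measure_sum_neg_log_le [IsProbabilityMeasure P] (hξ : IsBernoulliSeq P p ξ)
    {p₀ : ℝ} (hp₀ : 0 < p₀) (hp : ∀ i k, p₀ < p i k) (hp1 : ∀ i k, p i k ≤ 1)
    {c : ℝ} (hc : 0 < c) (n : ℕ) :
    P {ω | c ≤ |(∑ k ∈ Finset.range n, -Real.log (p (ξ k ω) k)) - entropySum p n|} ≤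
      ENNReal.ofReal (n * (Real.log p₀) ^ 2 / c ^ 2) := by
  set X : ℕ → Ω → ℝ := fun k ω => -Real.log (p (ξ k ω) k) with hX
  have hbd (i k) : -Real.log (p i k) ∈ Set.Icc 0 (-Real.log p₀) :=
    ⟨by linarith [Real.log_nonpos (hp₀.trans (hp i k)).le (hp1 i k)],
      by linarith [Real.log_le_log hp₀ (hp i k).le]⟩
  have hmeas (k) : Measurable (X k) :=
    (measurable_of_finite fun i => -Real.log (p i k)).comp (hξ.measurable k)
  have hmem (k) : MemLp (X k) 2 P := by
    refine MemLp.of_bound (hmeas k).aestronglyMeasurable (-Real.log p₀) (ae_of_all _ fun ω => ?_)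
    rw [Real.norm_eq_abs, abs_of_nonneg (hbd _ _).1]
    exact (hbd _ _).2
  have hind : iIndepFun X P :=
    hξ.indep.comp (fun k i => -Real.log (p i k)) fun k => measurable_of_finite _
  have hvar : variance (∑ k ∈ Finset.range n, X k) P ≤ n * (Real.log p₀) ^ 2 := by
    rw [IndepFun.variance_sum (fun k _ => hmem k) fun i _ j _ hij => hind.indepFun hij]
    refine (Finset.sum_le_card_nsmul _ _ ((Real.log p₀) ^ 2) fun k _ => ?_).trans_eq (by simp)
    refine (variance_le_sq_of_bounded (ae_of_all _ fun ω => hbd (ξ k ω) k)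
      (hmeas k).aemeasurable).trans ?_
    nlinarith [sq_nonneg (Real.log p₀)]
  have hE : ∫ ω, (∑ k ∈ Finset.range n, X k) ω ∂P = entropySum p n := by
    simp only [Finset.sum_apply]
    rw [integral_finsetSum _ fun k _ => (hmem k).integrable (by norm_num), entropySum]
    exact Finset.sum_congr rfl fun k _ =>
      hξ.integral_neg_log (fun i k => hp₀.trans (hp i k)) k
  have h := meas_ge_le_variance_div_sq (memLp_finsetSum' (Finset.range n) fun k _ => hmem k) hc
  rw [hE] at h
  simp only [Finset.sum_apply] at h
  exact h.trans (ENNReal.ofReal_le_ofReal (by gcongr))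

/-- A finite word, continued by zeros. -/
def wordExtend {n : ℕ} (w : Fin n → Fin 2) (k : ℕ) : Fin 2 :=
  if h : k < n then w ⟨k, h⟩ else 0

open Classical in
/-- The endpoints of the hull of the cylinder of `w`, if its probability is at least `exp (-b)`, and
of an empty interval otherwise. -/
noncomputable def heavyInterval (q : ℕ → ℕ) (p : Fin 2 → ℕ → ℝ) (b : ℝ) {n : ℕ}
    (w : Fin n → Fin 2) : ℝ × ℝ :=
  if Real.exp (-b) ≤ cylinderProb p (wordExtend w) n then
    (cylinderCenter q (wordExtend w) n - cylinderRadius q n,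
      cylinderCenter q (wordExtend w) n + cylinderRadius q n)
  else (1, 0)

lemma heavyInterval_subset (b : ℝ) {n : ℕ} (w : Fin n → Fin 2) :
    Set.Icc (heavyInterval q p b w).1 (heavyInterval q p b w).2 ⊆
      cylinderHull q (wordExtend w) n := by
  unfold heavyInterval
  split_ifs
  · exact le_rfl
  · simp

lemma IsSecondOstrogradsky.pairwise_disjoint_heavyInterval (hq : IsSecondOstrogradsky q) (b : ℝ)
    (n : ℕ) : Pairwise (Function.onFun Disjoint fun w : Fin n → Fin 2 =>
      Set.Icc (heavyInterval q p b w).1 (heavyInterval q p b w).2) := by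
  intro w w' hne
  refine Set.disjoint_left.mpr fun t ht ht' => hne ?_
  have h := hq.eq_of_mem_cylinderHull (heavyInterval_subset b w ht) (heavyInterval_subset b w' ht')
  ext k
  simpa [wordExtend] using congrArg Fin.val (h k k.2)

/-- On a heavy cylinder `ν ^ α = 2^(-(α-s)n) · 2^(-sn) ≤ 2^(-(α-s)n) · μ`, and the `μ`-masses of
disjoint sets sum to at most one. -/
lemma IsBernoulliSeq.tsum_heavyInterval_rpow_le [IsProbabilityMeasure P]
    (hξ : IsBernoulliSeq P p ξ) (hξ' : IsBernoulliSeq P' p' ξ') (hq : IsSecondOstrogradsky q)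
    (hp : ∀ i k, 0 ≤ p i k) (hp' : ∀ i k, p' i k = 1 / 2) {s : ℝ} {α : ℝ} (hα : 0 < α)
    (n : ℕ) :
    ∑' w : Fin n → Fin 2, P'.map (ostrogradskySum q ξ') (Set.Icc
        (heavyInterval q p (s * n * Real.log 2) w).1
        (heavyInterval q p (s * n * Real.log 2) w).2) ^ α ≤
      ENNReal.ofReal (Real.exp (-((α - s) * Real.log 2))) ^ n := by
  have hmeas := hξ.measurable_ostrogradskySum (q := q)
  have : IsProbabilityMeasure (P.map (ostrogradskySum q ξ)) :=
    Measure.isProbabilityMeasure_map hmeas.aemeasurable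
  set I : (Fin n → Fin 2) → Set ℝ := fun w => Set.Icc
    (heavyInterval q p (s * n * Real.log 2) w).1 (heavyInterval q p (s * n * Real.log 2) w).2
    with hI
  set ρ : ℝ≥0∞ := ENNReal.ofReal (Real.exp (-((α - s) * Real.log 2))) ^ n with hρ
  have key (w) : P'.map (ostrogradskySum q ξ') (I w) ^ α ≤
      ρ * P.map (ostrogradskySum q ξ) (I w) := by
    by_cases hw : Real.exp (-(s * n * Real.log 2)) ≤ cylinderProb p (wordExtend w) n
    · have hIw : I w = cylinderHull q (wordExtend w) n := by
        simp only [hI, heavyInterval, if_pos hw]; rfl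
      have hhalf : cylinderProb p' (wordExtend w) n = Real.exp (-(n * Real.log 2)) := by
        simp only [cylinderProb, hp', Finset.prod_const, Finset.card_range]
        rw [Real.exp_neg, Real.exp_nat_mul, Real.exp_log (by norm_num)]
        simp
      rw [hIw, hξ.map_cylinderHull hq hp, hξ'.map_cylinderHull hq (by simp [hp']), hhalf,
        ENNReal.ofReal_rpow_of_nonneg (Real.exp_nonneg _) hα.le, ← Real.exp_mul, hρ,
        ← ENNReal.ofReal_pow (Real.exp_nonneg _), ← ENNReal.ofReal_mul (by positivity),
        ← Real.exp_nat_mul]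
      refine ENNReal.ofReal_le_ofReal ?_
      refine le_trans (le_of_eq ?_) (mul_le_mul_of_nonneg_left hw (Real.exp_nonneg _))
      rw [← Real.exp_add]
      congr 1; ring
    · have hIw : I w = ∅ := by simp [hI, heavyInterval, if_neg hw]
      simp [hIw, hα]
  calc ∑' w, P'.map (ostrogradskySum q ξ') (I w) ^ α
      ≤ ∑' w, ρ * P.map (ostrogradskySum q ξ) (I w) := ENNReal.tsum_le_tsum key
    _ = ρ * ∑' w, P.map (ostrogradskySum q ξ) (I w) := ENNReal.tsum_mul_left
    _ = ρ * P.map (ostrogradskySum q ξ) (⋃ w, I w) := by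
        rw [measure_iUnion (hq.pairwise_disjoint_heavyInterval _ n) fun w => measurableSet_Icc]
    _ ≤ ρ * 1 := by gcongr; exact prob_le_one
    _ = ρ := mul_one ρ

lemma IsBernoulliSeq.hbDimMeasure_le [IsProbabilityMeasure P]
    (hξ : IsBernoulliSeq P p ξ) (hξ' : IsBernoulliSeq P' p' ξ') (hq : IsSecondOstrogradsky q)
    {p₀ : ℝ} (hp₀ : 0 < p₀) (hp : ∀ i k, p₀ < p i k) (hp1 : ∀ i k, p i k ≤ 1)
    (hp' : ∀ i k, p' i k = 1 / 2) {t : ℝ} {α : ℝ≥0} (hα : 0 < α) (ht : t < α)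
    (hfreq : ∃ᶠ n : ℕ in atTop, entropySum p n ≤ t * n * Real.log 2) :
    hbDimMeasure (P.map (ostrogradskySum q ξ)) (P'.map (ostrogradskySum q ξ')) ≤ α := by
  have hL : 0 < Real.log 2 := Real.log_pos (by norm_num)
  have hpos (i k) : 0 < p i k := hp₀.trans (hp i k)
  obtain ⟨s, hts, hsα⟩ := exists_between ht
  have hmeas := hξ.measurable_ostrogradskySum (q := q)
  have : IsProbabilityMeasure (P.map (ostrogradskySum q ξ)) :=
    Measure.isProbabilityMeasure_map hmeas.aemeasurable
  set I : (n : ℕ) → (Fin n → Fin 2) → Set ℝ := fun n w => Set.Icc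
    (heavyInterval q p (s * n * Real.log 2) w).1 (heavyInterval q p (s * n * Real.log 2) w).2
    with hI
  set G : ℕ → Set ℝ := fun J => ⋃ i : Σ n : ℕ, (Fin (n + J) → Fin 2), I (i.1 + J) i.2 with hG
  have hGmeas (J) : MeasurableSet (G J) := MeasurableSet.iUnion fun i => measurableSet_Icc
  -- a point that avoids `G J` has light cylinders of all ranks from `J` on
  have hlight (J n : ℕ) (hn : J ≤ n) :
      ostrogradskySum q ξ ⁻¹' (G J)ᶜ ⊆ {ω | s * n * Real.log 2 - entropySum p n ≤
        |(∑ k ∈ Finset.range n, -Real.log (p (ξ k ω) k)) - entropySum p n|} := by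
    intro ω hω
    by_contra hcon
    rw [Set.mem_ofPred_eq, not_le] at hcon
    have hY : ∑ k ∈ Finset.range n, -Real.log (p (ξ k ω) k) ≤ s * n * Real.log 2 := by
      linarith [le_abs_self ((∑ k ∈ Finset.range n, -Real.log (p (ξ k ω) k)) - entropySum p n)]
    obtain ⟨m, rfl⟩ := Nat.exists_eq_add_of_le' hn
    refine hω (Set.mem_iUnion.mpr ⟨⟨m, fun k => ξ k ω⟩, ?_⟩)
    have hagree : ∀ k < m + J, ξ k ω = wordExtend (fun k : Fin (m + J) => ξ k ω) k :=
      fun k hk => by simp [wordExtend, hk]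
    have hheavy : Real.exp (-(s * ((m + J : ℕ) : ℝ) * Real.log 2)) ≤
        cylinderProb p (wordExtend fun k : Fin (m + J) => ξ k ω) (m + J) := by
      have : cylinderProb p (wordExtend fun k : Fin (m + J) => ξ k ω) (m + J) =
          Real.exp (∑ k ∈ Finset.range (m + J), Real.log (p (ξ k ω) k)) := by
        rw [Real.exp_sum, cylinderProb]
        refine Finset.prod_congr rfl fun k hk => ?_
        rw [← hagree k (Finset.mem_range.mp hk), Real.exp_log (hpos _ _)]
      rw [this, Real.exp_le_exp]
      rw [Finset.sum_neg_distrib] at hY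
      linarith
    have := (hq.tsum_mem_cylinderHull_iff _ (fun k => ξ k ω) (m + J)).mpr hagree
    simp only [hI, heavyInterval, if_pos hheavy]
    exact this
  have hfull (J) : P.map (ostrogradskySum q ξ) (G J) = 1 := by
    rw [← prob_compl_eq_zero_iff (hGmeas J), Measure.map_apply hmeas (hGmeas J).compl]
    set K : ℝ := (Real.log p₀) ^ 2 / ((s - t) * Real.log 2) ^ 2 with hK
    have h0 : Tendsto (fun n : ℕ => ENNReal.ofReal (K / n)) atTop (nhds 0) := by
      simpa using ENNReal.tendsto_ofReal (tendsto_const_div_atTop_nhds_zero_nat K)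
    -- The complement of `G J` has mass at most `K / n` for infinitely many `n`; this suffices.
    refine le_antisymm (ge_of_tendsto_of_frequently h0 ?_) zero_le
    refine (hfreq.and_eventually ((eventually_ge_atTop J).and (eventually_gt_atTop 0))).mono ?_
    rintro n ⟨hH, hJ, hn⟩
    have hn' : (0 : ℝ) < n := by exact_mod_cast hn
    have hst : 0 < s - t := sub_pos.mpr hts
    have hcpos : 0 < (s - t) * n * Real.log 2 := by positivity
    refine (measure_mono ((hlight J n hJ).trans ?_)).trans
      ((hξ.measure_sum_neg_log_le hp₀ hp hp1 hcpos n).trans_eq ?_)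
    · intro ω hω
      rw [Set.mem_ofPred_eq] at hω ⊢
      refine le_trans ?_ hω
      nlinarith
    · congr 1
      rw [hK]
      field_simp
  -- Each `G J` covers the intersection, with covering sum at most the tail from `J` of a geometric
  -- series.
  refine iInf_le_of_le (⋂ J, G J) (iInf₂_le_of_le (MeasurableSet.iInter hGmeas) ?_ ?_)
  · rw [← prob_compl_eq_zero_iff (MeasurableSet.iInter hGmeas), Set.compl_iInter,
      measure_iUnion_null_iff]
    exact fun J => (prob_compl_eq_zero_iff (hGmeas J)).mpr (hfull J)
  · refine hbDim_le_of_hbMeasure_eq_zero hα (hbMeasure_eq_zero_of_countable_cover hα ?_)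
    intro η hη
    set ρ : ℝ≥0∞ := ENNReal.ofReal (Real.exp (-((α - s) * Real.log 2))) with hρ
    have hρ1 : ρ < 1 := by
      rw [hρ, ENNReal.ofReal_lt_one, Real.exp_lt_one_iff]
      nlinarith [mul_pos (sub_pos.mpr hsα) hL]
    have hgeom : ∑' n : ℕ, ρ ^ n ≠ ⊤ := by
      rw [ENNReal.tsum_geometric]
      simpa [tsub_eq_zero_iff_le] using hρ1
    obtain ⟨J, hJ⟩ :=
      ((ENNReal.tendsto_sum_nat_add (fun n => ρ ^ n) hgeom).eventually_lt_const hη).exists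
    refine ⟨Σ n : ℕ, (Fin (n + J) → Fin 2), inferInstance,
      Infinite.of_injective (fun n => ⟨n, 0⟩) fun a b h => congrArg Sigma.fst h,
      fun i => (heavyInterval q p (s * (i.1 + J : ℕ) * Real.log 2) i.2).1,
      fun i => (heavyInterval q p (s * (i.1 + J : ℕ) * Real.log 2) i.2).2,
      Set.iInter_subset G J, ?_⟩
    rw [ENNReal.tsum_sigma']
    refine le_trans (ENNReal.tsum_le_tsum fun n => ?_) hJ.le
    exact hξ.tsum_heavyInterval_rpow_le hξ' hq (fun i k => (hpos i k).le) hp' hα (n + J)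

end UpperBound

/-! ### The cycle of implications. -/

section Main

lemma digitEntropy_pos {p : Fin 2 → ℕ → ℝ} (hp : ∀ i k, 0 < p i k) (hp1 : ∀ i k, p i k < 1)
    (k : ℕ) : 0 < digitEntropy p k := by
  have h (i : Fin 2) : p i k * Real.log (p i k) < 0 :=
    mul_neg_of_pos_of_neg (hp i k) (Real.log_neg (hp i k) (hp1 i k))
  unfold digitEntropy
  linarith [h 0, h 1]

lemma positiveEntropyCount_eq {p : Fin 2 → ℕ → ℝ} (h : ∀ k, 0 < digitEntropy p k) (n : ℕ) :
    positiveEntropyCount p n = n := by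
  simp [positiveEntropyCount, h]

lemma one_le_hbDimMeasure_of_preservesHBDim {μ ν : Measure ℝ} [IsProbabilityMeasure μ]
    (h : PreservesHBDim (cdf μ) ν μ.support) : 1 ≤ hbDimMeasure μ ν := by
  refine le_iInf₂ fun E _ => le_iInf fun hE => ?_
  have hfull : μ (E ∩ μ.support) = 1 := by
    rw [measure_inter_conull Measure.measure_compl_support, hE]
  -- Preservation speaks only of subsets of the support, hence the intersection.
  calc 1 ≤ hbDim μ (E ∩ μ.support) := one_le_hbDim_self hfull
    _ = hbDim ν (E ∩ μ.support) := by
        rw [← h _ Set.inter_subset_right, measure_cdf]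
    _ ≤ hbDim ν E := hbDim_mono ν Set.inter_subset_left

variable {Ω Ω' : Type*} [MeasurableSpace Ω] [MeasurableSpace Ω'] {P : Measure Ω} {P' : Measure Ω'}
  {q : ℕ → ℕ} {p p' : Fin 2 → ℕ → ℝ} {ξ : ℕ → Ω → Fin 2} {ξ' : ℕ → Ω' → Fin 2}

lemma IsBernoulliSeq.hbDim_map_eq [IsProbabilityMeasure P] [IsProbabilityMeasure P']
    (hξ : IsBernoulliSeq P p ξ) (hξ' : IsBernoulliSeq P' p' ξ') (hq : IsSecondOstrogradsky q)
    (hsum : ∀ k, p 0 k + p 1 k = 1) {p₀ : ℝ} (hp₀ : 0 < p₀) (hp : ∀ i k, p₀ < p i k)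
    (hp1 : ∀ i k, p i k ≤ 1 - p₀) (hp' : ∀ i k, p' i k = 1 / 2)
    (hH : ∀ η > 0, ∀ᶠ n : ℕ in atTop, n * Real.log 2 - entropySum p n ≤ η * n) (E : Set ℝ) :
    hbDim (P.map (ostrogradskySum q ξ)) E = hbDim (P'.map (ostrogradskySum q ξ')) E := by
  have hL : 0 < Real.log 2 := Real.log_pos (by norm_num)
  have hpos (i k) : 0 < p i k := hp₀.trans (hp i k)
  have hpos' (i k) : 0 < p' i k := by rw [hp']; norm_num
  have hsum' (n : ℕ) (x : ℕ → Fin 2) :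
      ∑ k ∈ Finset.range n, Real.log (p' (x k) k) = -(n * Real.log 2) := by
    simp [hp']
  have hlog (n : ℕ) (x : ℕ → Fin 2) : ∑ k ∈ Finset.range n, Real.log (p (x k) k) =
      ∑ k ∈ Finset.range n, Real.log (2 * p (x k) k) - n * Real.log 2 := by
    rw [Finset.sum_congr rfl fun k _ => Real.log_mul two_ne_zero (hpos (x k) k).ne',
      Finset.sum_add_distrib]
    simp
  refine le_antisymm (hbDim_le_hbDim_of_Icc_le (fun s hs hs1 => ?_) E)
    (hbDim_le_hbDim_of_Icc_le (fun s hs hs1 => ?_) E)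
  all_goals
    have hs' : (0 : ℝ) < s := hs
    have hs1' : (s : ℝ) < 1 := hs1
    obtain ⟨A, hA⟩ := exists_abs_sum_log_two_mul_le hsum hp₀ hp hH
      -- The slack `δ = (1 - s) log 2` per digit is exactly what the exponent `s` leaves over in the
      -- first inequality.
      (mul_pos (sub_pos.mpr hs1') hL)
  · refine hξ.exists_map_Icc_le hξ' hq hpos hpos' ⟨1 - p₀, by linarith, hp1⟩
      ⟨A + s * Real.log 2, fun n x y => ?_⟩
    rw [hlog, hsum']
    have := (abs_le.mp (hA n x)).2
    push_cast
    nlinarith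
  · refine hξ'.exists_map_Icc_le hξ hq hpos' hpos ⟨1 / 2, by norm_num, fun i k => (hp' i k).le⟩
      ⟨s * (Real.log 2 + A + (1 - s) * Real.log 2), fun n x y => ?_⟩
    rw [hlog, hsum']
    have h1 := (abs_le.mp (hA (n + 1) y)).1
    have h2 := mul_le_mul_of_nonneg_left h1 hs'.le
    -- The coefficients of `n log 2` compare because `1 - s(2 - s) = (1 - s)²`.
    have h3 : 0 ≤ (n : ℝ) * Real.log 2 * (1 - s) ^ 2 := by positivity
    push_cast at h2 ⊢
    nlinarith

end Main

theorem mainTheorem5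
    {Ω Ω' : Type*} [MeasurableSpace Ω] [MeasurableSpace Ω']
    (P : Measure Ω) [IsProbabilityMeasure P] (P' : Measure Ω') [IsProbabilityMeasure P']
    (q : ℕ → ℕ) (hq : IsSecondOstrogradsky q)
    (p : Fin 2 → ℕ → ℝ) (hsum : ∀ k, p 0 k + p 1 k = 1)
    (hp : ∃ p₀ : ℝ, 0 < p₀ ∧ ∀ i k, p₀ < p i k)
    (ξ : ℕ → Ω → Fin 2) (hξ : IsBernoulliSeq P p ξ)
    (ξ' : ℕ → Ω' → Fin 2) (hξ' : IsBernoulliSeq P' (uniformProb p) ξ')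
    (μ ν : Measure ℝ) (hμ : μ = P.map (ostrogradskySum q ξ))
    (hν : ν = P'.map (ostrogradskySum q ξ')) :
    (PreservesHBDim (cdf μ) ν μ.support ↔ hbDimMeasure μ ν = 1) ∧
      (hbDimMeasure μ ν = 1 ↔
        liminf (fun n : ℕ => entropySum p n / ((positiveEntropyCount p n : ℝ) * Real.log 2))
          atTop = 1) := by
  obtain ⟨p₀, hp₀, hp⟩ := hp
  have hL : 0 < Real.log 2 := Real.log_pos (by norm_num)
  have hpos (i k) : 0 < p i k := hp₀.trans (hp i k)
  have hp1 (i : Fin 2) (k) : p i k ≤ 1 - p₀ := by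
    have h0 := hp 0 k
    have h1 := hp 1 k
    have h := hsum k
    fin_cases i <;> simp only [Fin.zero_eta, Fin.mk_one] <;> linarith
  have hple (i k) : p i k ≤ 1 := by linarith [hp1 i k]
  have hp' (i k) : uniformProb p i k = 1 / 2 := by
    rw [uniformProb, if_neg (hpos i k).ne', if_neg (by linarith [hp1 i k])]
  have hent := digitEntropy_pos hpos fun i k => by linarith [hp1 i k]
  have : IsProbabilityMeasure μ := by
    rw [hμ]
    exact Measure.isProbabilityMeasure_map hξ.measurable_ostrogradskySum.aemeasurable
  have hHle (n : ℕ) : entropySum p n ≤ n * Real.log 2 := by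
    refine (Finset.sum_le_card_nsmul _ _ _ fun k _ => digitEntropy_le_log_two hsum hpos k).trans_eq ?_
    simp
  have hbound {t : ℝ} {α : ℝ≥0} (hα : 0 < α) (ht : t < α)
      (hf : ∃ᶠ n : ℕ in atTop, entropySum p n ≤ t * n * Real.log 2) : hbDimMeasure μ ν ≤ α := by
    rw [hμ, hν]
    exact hξ.hbDimMeasure_le hξ' hq hp₀ hp hple hp' hα ht hf
  simp only [positiveEntropyCount_eq hent]
  set f : ℕ → ℝ := fun n => entropySum p n / ((n : ℝ) * Real.log 2) with hf
  have hf0 (n) : 0 ≤ f n :=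
    div_nonneg (Finset.sum_nonneg fun k _ => (hent k).le) (by positivity)
  have hf1 (n) : f n ≤ 1 := div_le_one_of_le₀ (hHle n) (by positivity)
  have hbdd : IsBoundedUnder (· ≥ ·) atTop f := isBoundedUnder_of ⟨0, hf0⟩
  have hcobdd : IsCoboundedUnder (· ≥ ·) atTop f :=
    (isBoundedUnder_of ⟨1, hf1⟩ : IsBoundedUnder (· ≤ ·) atTop f).isCoboundedUnder_ge
  have h12 (h : PreservesHBDim (cdf μ) ν μ.support) : hbDimMeasure μ ν = 1 := by
    refine le_antisymm (ENNReal.le_of_forall_pos_le_add fun ε hε _ => ?_)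
      (one_le_hbDimMeasure_of_preservesHBDim h)
    have := hbound (t := 1) (α := 1 + ε) (by positivity) (by push_cast; simpa using hε)
      (Frequently.of_forall fun n => by simpa using hHle n)
    simpa using this
  have h23 (h : hbDimMeasure μ ν = 1) : liminf f atTop = 1 := by
    refine le_antisymm ?_ ?_
    · exact liminf_le_of_frequently_le (Frequently.of_forall hf1) hbdd
    · by_contra hlt
      obtain ⟨t, hlt, ht1⟩ := exists_between (not_le.mp hlt)
      -- The maximum with 0 makes `r` a legitimate positive exponent without a sign condition on
      -- `t`.
      obtain ⟨r, hr, hr1⟩ := exists_between (max_lt ht1 one_pos)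
      have hr0 : 0 < r := (le_max_right _ _).trans_lt hr
      have hfr := frequently_lt_of_liminf_lt hcobdd hlt
      have := hbound (t := t) (α := ⟨r, hr0.le⟩) hr0 ((le_max_left _ _).trans_lt hr)
        (hfr.mono fun n hn => by
          rcases Nat.eq_zero_or_pos n with rfl | hn0
          · simp [entropySum]
          · have : (0 : ℝ) < n := by exact_mod_cast hn0
            rw [mul_assoc, ← div_le_iff₀ (by positivity)]
            exact hn.le)
      rw [h] at this
      have hr1' : (1 : ℝ≥0) ≤ ⟨r, hr0.le⟩ := ENNReal.one_le_coe_iff.mp this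
      exact absurd (show (1 : ℝ) ≤ r from hr1') (not_le.mpr hr1)
  have h31 (h : liminf f atTop = 1) : PreservesHBDim (cdf μ) ν μ.support := by
    intro E _
    rw [measure_cdf, hμ, hν]
    refine hξ.hbDim_map_eq hξ' hq hsum hp₀ hp hp1 hp' (fun η hη => ?_) E
    -- Multiplied by `n log 2`, this lower bound on the ratio is the required deficit bound `η n`.
    have hlt : 1 - η / Real.log 2 < liminf f atTop := by
      rw [h]; linarith [div_pos hη hL]
    filter_upwards [eventually_lt_of_lt_liminf hlt hbdd, eventually_gt_atTop 0] with n hn hn0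
    have : (0 : ℝ) < n := by exact_mod_cast hn0
    rw [hf, lt_div_iff₀ (by positivity)] at hn
    have h' : (1 - η / Real.log 2) * (n * Real.log 2) = n * Real.log 2 - η * n := by
      field_simp
    linarith
  exact ⟨⟨h12, fun h => h31 (h23 h)⟩, ⟨h23, fun h => h12 (h31 h)⟩⟩
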